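/- Let $M$ be a smooth manifold of dimension $2n+1$ (Hausdorff, second countable). An almost paracontact paracomplex Riemannian structure $(\phi,\xi,\eta,g)$ on $M$ consists of a smooth $(1,1)$-tensor field $\phi$, a smooth vector field $\xi$, a smooth 1-form $\eta$ and a Riemannian metric $g$ with $$\phi^2=\mathrm{id}-\eta\otimes\xi,\quad \eta(\xi)=1,\quad g(x,\xi)=\eta(x),\quad g(\phi x,\phi y)=g(x,y)-\eta(x)\eta(y),$$ such that the eigenspaces of $\phi$ on $H=\ker\eta$ for $1$ and $-1$ both have dimension $n$. Let $\nabla$ be the Levi-Civita connection of $g$, $Ric(x,y)=\operatorname{tr}(z\mapsto R(z,x)y)$ with $R(x,y)=[\nabla_x,\nabla_y]-\nabla_{[x,y]}$, and $F(x,y,z)=g((\nabla_x\phi)y,z)$. The structure is *para-Sasaki-like* if $F(X,Y,Z)=F(\xi,Y,Z)=F(\xi,\xi,Z)=0$ and $F(X,Y,\xi)=-g(X,Y)$ for all smooth sections $X,Y,Z$ of $H$. It is *Einstein* if $Ric=c\,g$ for a constant $c$. It is *$\eta$-paracomplex-Einstein* if there are real constants $p>|q|$ with $$Ric(x,y)=-\frac{2n}{p^2-q^2}\bigl\{p\,g(x,y)-q\,g(x,\phi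 y)+(p^2-q^2-p)\,\eta(x)\eta(y)\bigr\}\qquad(\ast)$$ for all $x,y$. A structure $(\phi,\bar\xi,\bar\eta,\bar g)$ on $M$ is *paracontact homothetic* to $(\phi,\xi,\eta,g)$ if there are real constants $u,v,w$ with $\bar\eta=e^{w}\eta$, $\bar\xi=e^{-w}\xi$ and $$\bar g(x,y)=e^{2u}\cosh(2v)\,g(x,y)+e^{2u}\sinh(2v)\,g(x,\phi y)+\{e^{2w}-e^{2u}\cosh(2v)\}\,\eta(x)\eta(y).$$ **Proposition.** Let $(M,\phi,\xi,\eta,g)$ be para-Sasaki-like. 1. If it is $\eta$-paracomplex-Einstein, then it is paracontact homothetic to an Einstein para-Sasaki-like structure on $M$. 2. (Pointwise form.) For all real constants $p>|q|$ there is a para-Sasaki-like structure $(\phi,\bar\xi,\bar\eta,\bar g)$ on $M$, paracontact homothetic to $(\phi,\xi,\eta,g)$, such that $\overline{Ric}=-2n\,\bar g$ holds at every point of $M$ at which $(\ast)$ holds with these $p,q$. -/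

import Mathlib

open Bundle VectorField
open scoped Manifold ContDiff

noncomputable section

namespace ParaSasaki

section Riemannian

variable {m : ℕ} {M : Type*} [TopologicalSpace M]
  [ChartedSpace (EuclideanSpace ℝ (Fin m)) M] [IsManifold (𝓡 m) ∞ M]

/-- The smooth vector fields on an `m`-dimensional smooth manifold without boundary. -/
abbrev SmoothField (m : ℕ) (M : Type*) [TopologicalSpace M]
    [ChartedSpace (EuclideanSpace ℝ (Fin m)) M] [IsManifold (𝓡 m) ∞ M] :=
  Cₛ^∞⟮𝓡 m; EuclideanSpace ℝ (Fin m), fun x : M ↦ TangentSpace (𝓡 m) x⟯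

/-- Differentiability at a point of a (not necessarily continuous) vector field. -/
abbrev FieldDiffAt (X : Π x : M, TangentSpace (𝓡 m) x) (x : M) : Prop :=
  MDifferentiableAt (𝓡 m) ((𝓡 m).prod 𝓘(ℝ, EuclideanSpace ℝ (Fin m)))
    (fun y ↦ TotalSpace.mk' (EuclideanSpace ℝ (Fin m)) y (X y)) x

/-- The smooth Riemannian metrics on `M`. -/
abbrev Metric (m : ℕ) (M : Type*) [TopologicalSpace M]
    [ChartedSpace (EuclideanSpace ℝ (Fin m)) M] [IsManifold (𝓡 m) ∞ M] :=
  ContMDiffRiemannianMetric (𝓡 m) ∞ (EuclideanSpace ℝ (Fin m))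
    (fun x : M ↦ TangentSpace (𝓡 m) x)


/-- The Levi-Civita connection of `g`: the smooth torsion-free connection on the tangent bundle
for which `v (g(Y, Z)) = g(∇_v Y, Z) + g(Y, ∇_v Z)`. As in Mathlib, `∇_v Y` at the point `x`
is written `D Y x v`. -/
structure LeviCivita (g : Metric m M) where
  D : CovariantDerivative (𝓡 m) (EuclideanSpace ℝ (Fin m)) (fun x : M ↦ TangentSpace (𝓡 m) x)
  smooth : D.ContMDiffCovariantDerivative ∞
  torsion_free : ∀ (X Y : Π x : M, TangentSpace (𝓡 m) x) (x : M),
    FieldDiffAt X x → FieldDiffAt Y x →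
      D Y x (X x) - D X x (Y x) = mlieBracket (𝓡 m) X Y x
  metric : ∀ (Y Z : Π x : M, TangentSpace (𝓡 m) x) (x : M) (v : TangentSpace (𝓡 m) x),
    FieldDiffAt Y x → FieldDiffAt Z x →
      mvfderiv (𝓡 m) (fun y ↦ g.inner y (Y y) (Z y)) x v =
        g.inner x (D Y x v) (Z x) + g.inner x (Y x) (D Z x v)

variable {g : Metric m M}

/-- The curvature `R(X, Y)Z = ∇_X ∇_Y Z - ∇_Y ∇_X Z - ∇_[X, Y] Z` at the point `x`. -/
def LeviCivita.curvature (L : LeviCivita g) (X Y Z : Π x : M, TangentSpace (𝓡 m) x) (x : M) :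
    TangentSpace (𝓡 m) x :=
  L.D (fun y ↦ L.D Z y (Y y)) x (X x) - L.D (fun y ↦ L.D Z y (X y)) x (Y x)
    - L.D Z x (mlieBracket (𝓡 m) X Y x)

theorem LeviCivita.curvature_tensorial (L : LeviCivita g) (Y Z : SmoothField m M) (x : M) :
    TensorialAt (𝓡 m) (EuclideanSpace ℝ (Fin m)) (fun X ↦ L.curvature X Y Z x) x := by
  have h1 : ∀ X : Π x : M, TangentSpace (𝓡 m) x, FieldDiffAt X x →
      FieldDiffAt (fun y ↦ L.D Z y (X y)) x := by
    intro X hX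
    have := L.smooth.contMDiff.contMDiff (σ := Z) (by simpa using Z.contMDiff.contMDiffOn)
    have := ((this.contMDiffAt Filter.univ_mem (x := x)).mdifferentiableAt (by simp))
    exact MDifferentiableAt.clm_bundle_apply this hX
  have hY : FieldDiffAt (fun y ↦ Y y) x :=
    (Y.contMDiff x).mdifferentiableAt (by simp)
  have hc := L.D.isCovariantDerivativeOn (s := Set.univ)
  constructor
  · intro f X hf hX
    have e : (fun y ↦ L.D Z y ((f • X) y)) = f • (fun y ↦ L.D Z y (X y)) := by
      ext1 y; simp
    simp only [LeviCivita.curvature, e]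
    rw [hc.leibniz (h1 X hX) hf, mlieBracket_smul_left hf hX]
    simp
    module
  · intro X X' hX hX'
    have e : (fun y ↦ L.D Z y ((X + X') y)) =
        (fun y ↦ L.D Z y (X y)) + (fun y ↦ L.D Z y (X' y)) := by
      ext1 y; simp
    simp only [LeviCivita.curvature, e]
    rw [hc.add (h1 X hX) (h1 X' hX'), mlieBracket_add_left hX hX']
    simp
    module

/-- The Ricci tensor `Ric(Y, Z) = tr (v ↦ R(v, Y)Z)` at the point `x`. -/
def LeviCivita.ricci (L : LeviCivita g) (Y Z : SmoothField m M) (x : M) : ℝ :=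
  LinearMap.trace ℝ (TangentSpace (𝓡 m) x)
    (TensorialAt.mkHom (fun X ↦ L.curvature X Y Z x) x (L.curvature_tensorial Y Z x)).toLinearMap

end Riemannian

section Structures

/-- An almost paracontact paracomplex Riemannian structure `(φ, ξ, η, g)` on a manifold of
dimension `2n + 1`. -/
structure ApcpcR (n : ℕ) (M : Type*) [TopologicalSpace M]
    [ChartedSpace (EuclideanSpace ℝ (Fin (2 * n + 1))) M]
    [IsManifold (𝓡 (2 * n + 1)) ∞ M] where
  /-- the (1,1)-tensor field -/
  φ : Π x : M, TangentSpace (𝓡 (2 * n + 1)) x →L[ℝ] TangentSpace (𝓡 (2 * n + 1)) x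
  φ_smooth : ContMDiff (𝓡 (2 * n + 1))
    ((𝓡 (2 * n + 1)).prod
      𝓘(ℝ, EuclideanSpace ℝ (Fin (2 * n + 1)) →L[ℝ] EuclideanSpace ℝ (Fin (2 * n + 1)))) ∞
    (fun x ↦ TotalSpace.mk'
      (EuclideanSpace ℝ (Fin (2 * n + 1)) →L[ℝ] EuclideanSpace ℝ (Fin (2 * n + 1)))
      (E := fun x : M ↦ TangentSpace (𝓡 (2 * n + 1)) x →L[ℝ] TangentSpace (𝓡 (2 * n + 1)) x)
      x (φ x))
  /-- the Reeb vector field -/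
  ξ : SmoothField (2 * n + 1) M
  /-- the 1-form -/
  η : Π x : M, TangentSpace (𝓡 (2 * n + 1)) x →L[ℝ] ℝ
  η_smooth : ContMDiff (𝓡 (2 * n + 1))
    ((𝓡 (2 * n + 1)).prod 𝓘(ℝ, EuclideanSpace ℝ (Fin (2 * n + 1)) →L[ℝ] ℝ)) ∞
    (fun x ↦ TotalSpace.mk' (EuclideanSpace ℝ (Fin (2 * n + 1)) →L[ℝ] ℝ)
      (E := fun x : M ↦ TangentSpace (𝓡 (2 * n + 1)) x →L[ℝ] ℝ) x (η x))
  /-- the associated Riemannian metric -/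
  g : Metric (2 * n + 1) M
  φ_sq : ∀ (x : M) (v : TangentSpace (𝓡 (2 * n + 1)) x), φ x (φ x v) = v - η x v • ξ x
  η_ξ : ∀ x : M, η x (ξ x) = 1
  /-- the eigenspaces of `φ` on `H = ker η` for `1` and `-1` have equal dimension `n` -/
  finrank_pos : ∀ x : M, Module.finrank ℝ
    ↥(Module.End.eigenspace (φ x).toLinearMap (1 : ℝ) ⊓ LinearMap.ker (η x).toLinearMap) = n
  finrank_neg : ∀ x : M, Module.finrank ℝ
    ↥(Module.End.eigenspace (φ x).toLinearMap (-1 : ℝ) ⊓ LinearMap.ker (η x).toLinearMap) = n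
  g_ξ : ∀ (x : M) (v : TangentSpace (𝓡 (2 * n + 1)) x), g.inner x v (ξ x) = η x v
  g_φ : ∀ (x : M) (v w : TangentSpace (𝓡 (2 * n + 1)) x),
    g.inner x (φ x v) (φ x w) = g.inner x v w - η x v * η x w

namespace ApcpcR

variable {n : ℕ} {M : Type*} [TopologicalSpace M]
  [ChartedSpace (EuclideanSpace ℝ (Fin (2 * n + 1))) M] [IsManifold (𝓡 (2 * n + 1)) ∞ M]

/-- The structure tensor `F(X, Y, Z) = g((∇_X φ)Y, Z)`, where `(∇_X φ)Y = ∇_X (φY) - φ(∇_X Y)`. -/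
def F (S : ApcpcR n M) (L : LeviCivita S.g) (X Y Z : SmoothField (2 * n + 1) M) (x : M) : ℝ :=
  S.g.inner x (L.D (fun y ↦ S.φ y (Y y)) x (X x) - S.φ x (L.D Y x (X x))) (Z x)

/-- Horizontal vector fields: sections of `H = ker η`. -/
def Horizontal (S : ApcpcR n M) (X : SmoothField (2 * n + 1) M) : Prop :=
  ∀ x, S.η x (X x) = 0

/-- The para-Sasaki-like condition: for horizontal `X, Y, Z`,
`F(X, Y, Z) = F(ξ, Y, Z) = F(ξ, ξ, Z) = 0` and `F(X, Y, ξ) = -g(X, Y)`,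
where `F` is formed with the Levi-Civita connection of `g`. -/
def IsParaSasakiLike (S : ApcpcR n M) : Prop :=
  ∃ L : LeviCivita S.g, ∀ X Y Z : SmoothField (2 * n + 1) M,
    S.Horizontal X → S.Horizontal Y → S.Horizontal Z → ∀ x : M,
      S.F L X Y Z x = 0 ∧ S.F L S.ξ Y Z x = 0 ∧ S.F L S.ξ S.ξ Z x = 0 ∧
      S.F L X Y S.ξ x = -S.g.inner x (X x) (Y x)

/-- `Ric = c g` at the point `x`. -/
def EinsteinAt (S : ApcpcR n M) (c : ℝ) (x : M) : Prop :=
  ∃ L : LeviCivita S.g, ∀ X Y : SmoothField (2 * n + 1) M,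
    L.ricci X Y x = c * S.g.inner x (X x) (Y x)

/-- `g` is an Einstein metric: `Ric = c g` with a constant `c`. -/
def IsEinstein (S : ApcpcR n M) : Prop :=
  ∃ c : ℝ, ∀ x : M, S.EinsteinAt c x

/-- The identity
`Ric(X, Y) = -2n / (p² - q²) (p g(X, Y) - q g(X, φY) + (p² - q² - p) η(X) η(Y))`
at the point `x`. -/
def EtaParacomplexEinsteinAt (S : ApcpcR n M) (p q : ℝ) (x : M) : Prop :=
  ∃ L : LeviCivita S.g, ∀ X Y : SmoothField (2 * n + 1) M,
    L.ricci X Y x = -(2 * n / (p ^ 2 - q ^ 2)) *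
      (p * S.g.inner x (X x) (Y x) - q * S.g.inner x (X x) (S.φ x (Y x))
        + (p ^ 2 - q ^ 2 - p) * (S.η x (X x) * S.η x (Y x)))

/-- The `η`-paracomplex-Einstein condition. The constants are the coefficients
`p = exp (2u) cosh (2v)`, `q = exp (2u) sinh (2v)` of a metric `p g + q g(·, φ·) + (1 - p) η ⊗ η`;
the pairs of this form are those with `|q| < p`. -/
def IsEtaParacomplexEinstein (S : ApcpcR n M) : Prop :=
  ∃ p q : ℝ, |q| < p ∧ ∀ x : M, S.EtaParacomplexEinsteinAt p q x

/-- `S'` arises from `S` by a paracontact homothetic transformation, with constants `u, v, w`. -/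
def IsParacontactHomothetic (S S' : ApcpcR n M) : Prop :=
  ∃ u v w : ℝ,
    (∀ x, S'.φ x = S.φ x) ∧
    (∀ x, S'.ξ x = Real.exp (-w) • S.ξ x) ∧
    (∀ x, S'.η x = Real.exp w • S.η x) ∧
    ∀ (x : M) (y z : TangentSpace (𝓡 (2 * n + 1)) x),
      S'.g.inner x y z =
        Real.exp (2 * u) * Real.cosh (2 * v) * S.g.inner x y z
        + Real.exp (2 * u) * Real.sinh (2 * v) * S.g.inner x y (S.φ x z)
        + (Real.exp (2 * w) - Real.exp (2 * u) * Real.cosh (2 * v)) * (S.η x y * S.η x z)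

end ApcpcR

end Structures

end ParaSasaki

end

/-!
For constants `|q| < p` the tensor `p g + q g(φ ·, ·) + (1 - p) η ⊗ η` is a Riemannian metric, and
it defines a paracontact homothetic deformation of the structure with the same `φ`, `ξ`, `η`
(`ApcpcR.deform`; `w = 0` and `p = exp (2u) cosh (2v)`, `q = exp (2u) sinh (2v)`). The point is that
such a deformation of a para-Sasaki-like structure changes the metric but not the Ricci tensor. So
`Ric = -2n ((p g - q g(φ ·, ·)) / (p² - q²) + (1 - p / (p² - q²)) η ⊗ η)` says exactly that the
deformation with constants `p / (p² - q²)` and `-q / (p² - q²)` satisfies `Ric = -2n g` for its own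
metric.

The para-Sasaki-like identities for horizontal fields are equivalent to `∇ξ = φ` and
`(∇_v φ) Y = -g(v, Y) ξ - η(Y) v + 2 η(v) η(Y) ξ` for all `v` and `Y`
(`ParaSasakiLikeFor.nablaFormulas`). With these the Koszul formula gives the Levi-Civita connection
of the deformed metric as `∇_v Y + B(v, Y) ξ`, where
`B = -q g + (1 - p) g(φ ·, ·) + q η ⊗ η` is symmetric and `B(ξ, ·) = 0` (`NablaFormulas.deform`,
where torsion-freeness and compatibility with the metric are checked directly). Hence the deformed
structure is para-Sasaki-like as well. The curvature changes by
`B(Y, Z) φ X - B(X, Z) φ Y + ((∇_X B)(Y, Z) - (∇_Y B)(X, Z)) ξ`, and the trace of this in `X`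
vanishes because `tr φ = 0` (`NablaFormulas.ricci_deform`).
-/

noncomputable section

/-! ### Smooth families of linear maps, global vector fields, uniqueness of the connection -/

section HomBundle

variable {𝕜 B F₁ F₂ F₃ : Type*} [NontriviallyNormedField 𝕜] {k : WithTop ℕ∞}
  {E₁ : B → Type*} [∀ x, AddCommGroup (E₁ x)] [∀ x, Module 𝕜 (E₁ x)]
  [NormedAddCommGroup F₁] [NormedSpace 𝕜 F₁]
  [TopologicalSpace (TotalSpace F₁ E₁)] [∀ x, TopologicalSpace (E₁ x)]
  {E₂ : B → Type*} [∀ x, AddCommGroup (E₂ x)] [∀ x, Module 𝕜 (E₂ x)]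
  [NormedAddCommGroup F₂] [NormedSpace 𝕜 F₂]
  [TopologicalSpace (TotalSpace F₂ E₂)] [∀ x, TopologicalSpace (E₂ x)]
  {E₃ : B → Type*} [∀ x, AddCommGroup (E₃ x)] [∀ x, Module 𝕜 (E₃ x)]
  [NormedAddCommGroup F₃] [NormedSpace 𝕜 F₃]
  [TopologicalSpace (TotalSpace F₃ E₃)] [∀ x, TopologicalSpace (E₃ x)]
  {EB : Type*} [NormedAddCommGroup EB] [NormedSpace 𝕜 EB]
  {HB : Type*} [TopologicalSpace HB] {IB : ModelWithCorners 𝕜 EB HB}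
  [TopologicalSpace B] [ChartedSpace HB B]
  [FiberBundle F₁ E₁] [VectorBundle 𝕜 F₁ E₁]
  [FiberBundle F₂ E₂] [VectorBundle 𝕜 F₂ E₂]
  [FiberBundle F₃ E₃] [VectorBundle 𝕜 F₃ E₃]
  [∀ x, IsTopologicalAddGroup (E₂ x)] [∀ x, ContinuousSMul 𝕜 (E₂ x)]
  [∀ x, IsTopologicalAddGroup (E₃ x)] [∀ x, ContinuousSMul 𝕜 (E₃ x)]
  {s : Set B} {x₀ : B}

/-- The composition of smooth families of continuous linear maps between vector bundles is
smooth. -/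
theorem ContMDiffWithinAt.clm_bundle_comp
    {ψ : ∀ x, E₂ x →L[𝕜] E₃ x} {φ : ∀ x, E₁ x →L[𝕜] E₂ x}
    (hψ : ContMDiffWithinAt IB (IB.prod 𝓘(𝕜, F₂ →L[𝕜] F₃)) k
      (fun x ↦ TotalSpace.mk' (F₂ →L[𝕜] F₃) (E := fun x ↦ E₂ x →L[𝕜] E₃ x) x (ψ x)) s x₀)
    (hφ : ContMDiffWithinAt IB (IB.prod 𝓘(𝕜, F₁ →L[𝕜] F₂)) k
      (fun x ↦ TotalSpace.mk' (F₁ →L[𝕜] F₂) (E := fun x ↦ E₁ x →L[𝕜] E₂ x) x (φ x)) s x₀) :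
    ContMDiffWithinAt IB (IB.prod 𝓘(𝕜, F₁ →L[𝕜] F₃)) k
      (fun x ↦ TotalSpace.mk' (F₁ →L[𝕜] F₃) (E := fun x ↦ E₁ x →L[𝕜] E₃ x) x
        ((ψ x).comp (φ x))) s x₀ := by
  rw [contMDiffWithinAt_hom_bundle] at hψ hφ ⊢
  refine ⟨hφ.1, (hψ.2.clm_comp hφ.2).congr_of_eventuallyEq ?_ ?_⟩
  · filter_upwards [mem_nhdsWithin_of_mem_nhds
      ((trivializationAt F₂ E₂ x₀).open_baseSet.mem_nhds
        (FiberBundle.mem_baseSet_trivializationAt' x₀))] with x h₂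
    ext v
    simp [ContinuousLinearMap.inCoordinates, h₂]
  · ext v
    simp [ContinuousLinearMap.inCoordinates,
      FiberBundle.mem_baseSet_trivializationAt']

/-- The tensor product of a smooth section of a dual bundle with a smooth section of a bundle,
as a family of rank one maps, is smooth. -/
theorem ContMDiffWithinAt.smulRight_section
    {α : ∀ x, E₁ x →L[𝕜] 𝕜} {σ : ∀ x, E₂ x}
    (hα : ContMDiffWithinAt IB (IB.prod 𝓘(𝕜, F₁ →L[𝕜] 𝕜)) k
      (fun x ↦ TotalSpace.mk' (F₁ →L[𝕜] 𝕜) (E := fun x ↦ E₁ x →L[𝕜] Trivial B 𝕜 x) x (α x)) s x₀)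
    (hσ : ContMDiffWithinAt IB (IB.prod 𝓘(𝕜, F₂)) k (fun x ↦ TotalSpace.mk' F₂ x (σ x)) s x₀) :
    ContMDiffWithinAt IB (IB.prod 𝓘(𝕜, F₁ →L[𝕜] F₂)) k
      (fun x ↦ TotalSpace.mk' (F₁ →L[𝕜] F₂) (E := fun x ↦ E₁ x →L[𝕜] E₂ x) x
        ((α x).smulRight (σ x))) s x₀ := by
  rw [contMDiffWithinAt_hom_bundle] at hα ⊢
  rw [contMDiffWithinAt_section] at hσ
  have key : ContMDiffWithinAt IB 𝓘(𝕜, F₁ →L[𝕜] F₂) k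
      (fun x ↦ (ContinuousLinearMap.smulRightL 𝕜 F₁ F₂)
        (ContinuousLinearMap.inCoordinates F₁ E₁ 𝕜 (Trivial B 𝕜) x₀ x x₀ x (α x))
        (trivializationAt F₂ E₂ x₀ ⟨x, σ x⟩).2) s x₀ :=
    (contMDiffWithinAt_const.clm_apply hα.2).clm_apply hσ
  refine ⟨hα.1, key.congr_of_eventuallyEq ?_ ?_⟩
  · filter_upwards [mem_nhdsWithin_of_mem_nhds
      ((trivializationAt F₂ E₂ x₀).open_baseSet.mem_nhds
        (FiberBundle.mem_baseSet_trivializationAt' x₀))] with x h₂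
    ext v
    simp [ContinuousLinearMap.inCoordinates, h₂]
  · ext v
    simp [ContinuousLinearMap.inCoordinates,
      FiberBundle.mem_baseSet_trivializationAt']

end HomBundle

namespace ParaSasaki

section Riemannian

variable {m : ℕ} {M : Type*} [TopologicalSpace M]
  [ChartedSpace (EuclideanSpace ℝ (Fin m)) M] [IsManifold (𝓡 m) ∞ M]

theorem SmoothField.diffAt (X : SmoothField m M) (x : M) : FieldDiffAt (fun y ↦ X y) x :=
  (X.contMDiff x).mdifferentiableAt (by simp)

/-- Every tangent vector is the value of a global smooth vector field: cut off a local extension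
by a bump function. -/
theorem exists_smoothField_eq [T2Space M] (x : M) (v : TangentSpace (𝓡 m) x) :
    ∃ X : SmoothField m M, X x = v := by
  obtain ⟨s, hs, hv⟩ := FiberBundle.exists_contMDiffOn_extend (k := ∞) (𝓡 m)
    (EuclideanSpace ℝ (Fin m)) v
  obtain ⟨f, -, hf⟩ := (SmoothBumpFunction.nhds_basis_tsupport (I := 𝓡 m) x).mem_iff.1
    (interior_mem_nhds.2 hs)
  refine ⟨⟨_, ContMDiffOn.smul_section_of_tsupport (f.contMDiff.contMDiffOn) isOpen_interior hf
    (hv.mono interior_subset)⟩, ?_⟩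
  simp

/-- Smoothness of a field of bilinear forms on the tangent spaces. -/
abbrev SmoothForm (β : Π x : M,
    TangentSpace (𝓡 m) x →L[ℝ] TangentSpace (𝓡 m) x →L[ℝ] ℝ) : Prop :=
  ContMDiff (𝓡 m)
    ((𝓡 m).prod 𝓘(ℝ, EuclideanSpace ℝ (Fin m) →L[ℝ]
      EuclideanSpace ℝ (Fin m) →L[ℝ] ℝ)) ∞
    (fun x ↦ TotalSpace.mk' (EuclideanSpace ℝ (Fin m) →L[ℝ]
        EuclideanSpace ℝ (Fin m) →L[ℝ] ℝ)
      (E := fun x : M ↦ TangentSpace (𝓡 m) x →L[ℝ]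
        TangentSpace (𝓡 m) x →L[ℝ] ℝ) x (β x))

theorem SmoothForm.add {β γ : Π x : M,
    TangentSpace (𝓡 m) x →L[ℝ] TangentSpace (𝓡 m) x →L[ℝ] ℝ}
    (hβ : SmoothForm β) (hγ : SmoothForm γ) : SmoothForm (fun x ↦ β x + γ x) :=
  ContMDiff.add_section hβ hγ

theorem SmoothForm.smul {β : Π x : M,
    TangentSpace (𝓡 m) x →L[ℝ] TangentSpace (𝓡 m) x →L[ℝ] ℝ}
    (hβ : SmoothForm β) (a : ℝ) : SmoothForm (fun x ↦ a • β x) :=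
  ContMDiff.const_smul_section hβ

variable {g : Metric m M}

theorem Metric.eq_zero_of_inner_self (g : Metric m M) {x : M} {v : TangentSpace (𝓡 m) x}
    (h : g.inner x v v = 0) : v = 0 := by
  by_contra hv
  exact (g.pos x v hv).ne' h

/-- The metric is nondegenerate. -/
theorem Metric.ext_inner (g : Metric m M) {x : M} {v w : TangentSpace (𝓡 m) x}
    (h : ∀ z, g.inner x v z = g.inner x w z) : v = w := by
  rw [← sub_eq_zero]
  apply g.eq_zero_of_inner_self
  rw [map_sub]
  simp [h]

theorem Metric.diffAt_inner (g : Metric m M) {Y Z : Π x : M, TangentSpace (𝓡 m) x} {x : M}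
    (hY : FieldDiffAt Y x) (hZ : FieldDiffAt Z x) :
    MDifferentiableAt (𝓡 m) 𝓘(ℝ) (fun y ↦ g.inner y (Y y) (Z y)) x := by
  have := ((g.contMDiff x).mdifferentiableAt (by simp)).clm_bundle_apply₂
    (E₃ := Trivial M ℝ) (F₃ := ℝ) hY hZ
  exact (mdifferentiableAt_totalSpace _ _).1 this |>.2

/-- The Levi-Civita connection is unique: the difference of two is a symmetric tensor which is
skew with respect to the metric. -/
theorem LeviCivita.eq_of_diffAt (L L' : LeviCivita g) {Y : Π x : M, TangentSpace (𝓡 m) x} {x : M}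
    (hY : FieldDiffAt Y x) (v : TangentSpace (𝓡 m) x) : L.D Y x v = L'.D Y x v := by
  have hd {X : Π x : M, TangentSpace (𝓡 m) x} (hX : FieldDiffAt X x) :
      L.D.difference L'.D x (X x) = L.D X x - L'.D X x :=
    IsCovariantDerivativeOn.difference_apply _ _ (by trivial) hX
  generalize L.D.difference L'.D x = A at hd
  have hsymm (v w) : A v w = A w v := by
    have hV := FiberBundle.mdifferentiableAt_extend (𝓡 m) (EuclideanSpace ℝ (Fin m)) v
    have hW := FiberBundle.mdifferentiableAt_extend (𝓡 m) (EuclideanSpace ℝ (Fin m)) w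
    have h1 := L.torsion_free _ _ x hV hW
    have h2 := L'.torsion_free _ _ x hV hW
    have h3 := hd hV
    have h4 := hd hW
    simp only [FiberBundle.extend_apply_self] at h1 h2 h3 h4
    rw [h3, h4]
    simp only [sub_apply]
    rw [← h2] at h1
    linear_combination (norm := module) -h1
  have hskew (u v w) : g.inner x (A v u) w + g.inner x v (A w u) = 0 := by
    have hV := FiberBundle.mdifferentiableAt_extend (𝓡 m) (EuclideanSpace ℝ (Fin m)) v
    have hW := FiberBundle.mdifferentiableAt_extend (𝓡 m) (EuclideanSpace ℝ (Fin m)) w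
    have h1 := L.metric _ _ x u hV hW
    have h2 := L'.metric _ _ x u hV hW
    have h3 := hd hV
    have h4 := hd hW
    simp only [FiberBundle.extend_apply_self] at h1 h2 h3 h4
    rw [h3, h4]
    simp only [sub_apply, map_sub]
    linarith
  -- a trilinear form symmetric in two arguments and skew in two others vanishes
  have hA (u v w) : g.inner x (A v u) w = 0 := by
    have e1 := hskew u v w
    have e2 := hskew v w u
    have e3 := hskew w u v
    rw [hsymm v u, g.symm x v] at *
    rw [hsymm w v, g.symm x w] at *
    rw [hsymm u w, g.symm x u] at *
    linarith
  have := hd hY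
  have h0 : A (Y x) v = 0 := g.eq_zero_of_inner_self (hA _ _ _)
  rw [this] at h0
  simpa [sub_eq_zero] using h0

end Riemannian

end ParaSasaki

/-! ### Pointwise algebra of the structure tensors -/

namespace ParaSasaki

namespace ApcpcR

variable {n : ℕ} {M : Type*} [TopologicalSpace M]
  [ChartedSpace (EuclideanSpace ℝ (Fin (2 * n + 1))) M] [IsManifold (𝓡 (2 * n + 1)) ∞ M]
  (S : ApcpcR n M)

section Algebra

variable (x : M) (v w : TangentSpace (𝓡 (2 * n + 1)) x)

@[simp]
theorem φ_ξ : S.φ x (S.ξ x) = 0 := by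
  have h1 := S.φ_sq x (S.ξ x)
  rw [S.η_ξ, one_smul, sub_self] at h1
  have h2 := S.φ_sq x (S.φ x (S.ξ x))
  rw [h1, map_zero] at h2
  have h3 : S.φ x (S.ξ x) = S.η x (S.φ x (S.ξ x)) • S.ξ x := (sub_eq_zero.1 h2.symm)
  have h4 : S.φ x (S.φ x (S.ξ x)) = S.η x (S.φ x (S.ξ x)) • S.φ x (S.ξ x) := by
    conv_lhs => rw [h3]
    rw [map_smul]
  rw [h1] at h4
  rcases smul_eq_zero.1 h4.symm with h | h
  · rw [h3, h, zero_smul]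
  · exact h

theorem ξ_ne_zero : S.ξ x ≠ 0 := fun h ↦ by simpa [h] using S.η_ξ x

@[simp]
theorem η_φ : S.η x (S.φ x v) = 0 := by
  have h1 := congrArg (S.φ x) (S.φ_sq x v)
  rw [S.φ_sq x (S.φ x v), map_sub, map_smul, S.φ_ξ, smul_zero, sub_zero, sub_eq_self] at h1
  exact (smul_eq_zero.1 h1).resolve_right (S.ξ_ne_zero x)

theorem g_ξ_left : S.g.inner x (S.ξ x) v = S.η x v := by rw [S.g.symm, S.g_ξ]

/-- `φ` is symmetric with respect to the metric. -/
theorem g_φ_comm : S.g.inner x (S.φ x v) w = S.g.inner x v (S.φ x w) := by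
  have h := S.g_φ x v (S.φ x w)
  rw [S.φ_sq, map_sub, map_smul, S.g_ξ] at h
  simpa using h

/-- The Cauchy-Schwarz inequality for `φ v` and the horizontal part of `v`, which have the same
length. -/
theorem abs_g_φ_self_le : |S.g.inner x (S.φ x v) v| ≤ S.g.inner x v v - S.η x v * S.η x v := by
  have nonneg (u : TangentSpace (𝓡 (2 * n + 1)) x) : 0 ≤ S.g.inner x u u := by
    by_cases hu : u = 0
    · simp [hu]
    · exact (S.g.pos x u hu).le
  have h1 := nonneg (v - S.η x v • S.ξ x + S.φ x v)
  have h2 := nonneg (v - S.η x v • S.ξ x - S.φ x v)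
  simp only [map_add, map_sub, map_smul, add_apply, sub_apply, smul_apply, smul_eq_mul, S.g_φ,
    S.g_ξ, S.g_ξ_left, S.η_φ, S.η_ξ, ← S.g_φ_comm] at h1 h2
  rw [abs_le]
  constructor <;> linarith

/-- `φ` is trace-free because its eigenspaces for `1` and `-1` have the same dimension. -/
theorem trace_φ : LinearMap.trace ℝ (TangentSpace (𝓡 (2 * n + 1)) x) (S.φ x).toLinearMap = 0 := by
  have : FiniteDimensional ℝ (TangentSpace (𝓡 (2 * n + 1)) x) :=
    inferInstanceAs (FiniteDimensional ℝ (EuclideanSpace ℝ (Fin (2 * n + 1))))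
  set f := (S.φ x).toLinearMap with hf
  have hφ (u) : f (f u) = u - S.η x u • S.ξ x := S.φ_sq x u
  have hφ3 (u) : f (f (f u)) = f u := by
    rw [hφ u, map_sub, map_smul, hf]
    simp
  have hη (u) : S.η x (f u) = 0 := S.η_φ x u
  -- `(φ² + ε φ) / 2` is the projection onto the `ε`-eigenspace in `ker η`, for `ε = ± 1`
  have proj (ε : ℝ) (hε : ε * ε = 1) : LinearMap.IsProj
      (Module.End.eigenspace f ε ⊓ LinearMap.ker (S.η x).toLinearMap)
      ((1 / 2 : ℝ) • (f ∘ₗ f + ε • f)) := by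
    constructor
    · intro u
      refine ⟨Module.End.mem_eigenspace_iff.2 ?_, ?_⟩
      · simp only [LinearMap.smul_apply, LinearMap.add_apply, LinearMap.comp_apply, map_smul,
          map_add, hφ3]
        linear_combination (norm := module) (-(1 / 2 : ℝ) * hε) • f u
      · simp [hη]
    · rintro u ⟨h1, h2⟩
      replace h1 := Module.End.mem_eigenspace_iff.1 h1
      simp only [LinearMap.smul_apply, LinearMap.add_apply, LinearMap.comp_apply, h1, map_smul,
        smul_smul, hε]
      module
  have t1 := (proj 1 (by norm_num)).trace
  have t2 := (proj (-1) (by norm_num)).trace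
  rw [S.finrank_pos x] at t1
  rw [S.finrank_neg x] at t2
  simp only [map_smul, map_add, smul_eq_mul] at t1 t2
  linarith

end Algebra

end ApcpcR

end ParaSasaki

/-! ### Covariant derivatives of the structure tensors -/

namespace ParaSasaki

namespace ApcpcR

variable {n : ℕ} {M : Type*} [TopologicalSpace M]
  [ChartedSpace (EuclideanSpace ℝ (Fin (2 * n + 1))) M] [IsManifold (𝓡 (2 * n + 1)) ∞ M]
  (S : ApcpcR n M)

section Fields

theorem diffAt_φ {Y : Π x : M, TangentSpace (𝓡 (2 * n + 1)) x} {x : M} (hY : FieldDiffAt Y x) :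
    FieldDiffAt (fun y ↦ S.φ y (Y y)) x :=
  ((S.φ_smooth x).mdifferentiableAt (by simp)).clm_bundle_apply hY

theorem diffAt_η {Y : Π x : M, TangentSpace (𝓡 (2 * n + 1)) x} {x : M} (hY : FieldDiffAt Y x) :
    MDifferentiableAt (𝓡 (2 * n + 1)) 𝓘(ℝ) (fun y ↦ S.η y (Y y)) x := by
  simpa only [S.g_ξ] using S.g.diffAt_inner hY (S.ξ.diffAt x)

/-- Every horizontal vector is the value of a global horizontal field. -/
theorem exists_horizontal_eq [T2Space M] {x : M} {v : TangentSpace (𝓡 (2 * n + 1)) x}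
    (hv : S.η x v = 0) : ∃ X : SmoothField (2 * n + 1) M, S.Horizontal X ∧ X x = v := by
  -- `φ` maps all fields to horizontal ones and `v = φ (φ v)`
  obtain ⟨X, hX⟩ := exists_smoothField_eq (m := 2 * n + 1) x (S.φ x v)
  refine ⟨⟨fun y ↦ S.φ y (X y), S.φ_smooth.clm_bundle_apply X.contMDiff⟩, fun y ↦ S.η_φ y _, ?_⟩
  change S.φ x (X x) = v
  rw [hX, S.φ_sq, hv, zero_smul, sub_zero]

end Fields

variable {S}

/-- `Y ↦ (∇φ) Y` is tensorial. -/
theorem tensorialAt_nabla_φ (L : LeviCivita S.g) (x : M) :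
    TensorialAt (𝓡 (2 * n + 1)) (EuclideanSpace ℝ (Fin (2 * n + 1)))
      (fun Y : Π x : M, TangentSpace (𝓡 (2 * n + 1)) x ↦
        L.D (fun y ↦ S.φ y (Y y)) x - (S.φ x).comp (L.D Y x)) x := by
  have hc := L.D.isCovariantDerivativeOn (s := Set.univ)
  constructor
  · intro f Y hf hY
    have e : (fun y ↦ S.φ y ((f • Y) y)) = f • (fun y ↦ S.φ y (Y y)) := by
      ext1 y; simp
    simp only [e]
    rw [hc.leibniz (S.diffAt_φ hY) hf, hc.leibniz hY hf]
    ext1 v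
    simp
    module
  · intro Y Y' hY hY'
    have e : (fun y ↦ S.φ y ((Y + Y') y)) = (fun y ↦ S.φ y (Y y)) + (fun y ↦ S.φ y (Y' y)) := by
      ext1 y; simp
    simp only [e]
    rw [hc.add (S.diffAt_φ hY) (S.diffAt_φ hY'), hc.add hY hY']
    ext1 v
    simp
    abel

variable (S) in
/-- The covariant derivatives of `ξ` and `φ` on a para-Sasaki-like manifold, for all tangent
vectors and not only the horizontal ones. -/
structure NablaFormulas (L : LeviCivita S.g) : Prop where
  nabla_ξ (x : M) (v : TangentSpace (𝓡 (2 * n + 1)) x) : L.D S.ξ x v = S.φ x v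
  nabla_φ (Y : Π x : M, TangentSpace (𝓡 (2 * n + 1)) x) (x : M) (hY : FieldDiffAt Y x)
    (v : TangentSpace (𝓡 (2 * n + 1)) x) :
    L.D (fun y ↦ S.φ y (Y y)) x v = S.φ x (L.D Y x v) - S.g.inner x v (Y x) • S.ξ x
      - S.η x (Y x) • v + (2 * S.η x v * S.η x (Y x)) • S.ξ x

/-- The formulas do not depend on the choice of `L`, by uniqueness of the Levi-Civita connection.
-/
theorem NablaFormulas.congr {L : LeviCivita S.g} (h : S.NablaFormulas L) (L' : LeviCivita S.g) :
    S.NablaFormulas L' where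
  nabla_ξ x v := by rw [← h.nabla_ξ, L'.eq_of_diffAt L (S.ξ.diffAt x)]
  nabla_φ Y x hY v := by
    rw [L'.eq_of_diffAt L (S.diffAt_φ hY), L'.eq_of_diffAt L hY, h.nabla_φ Y x hY]

variable (S) in
/-- The para-Sasaki-like condition, with `F` formed by the given Levi-Civita connection `L`. -/
def ParaSasakiLikeFor (L : LeviCivita S.g) : Prop :=
  ∀ X Y Z : SmoothField (2 * n + 1) M,
    S.Horizontal X → S.Horizontal Y → S.Horizontal Z → ∀ x : M,
      S.F L X Y Z x = 0 ∧ S.F L S.ξ Y Z x = 0 ∧ S.F L S.ξ S.ξ Z x = 0 ∧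
      S.F L X Y S.ξ x = -S.g.inner x (X x) (Y x)

/-- The decomposition of a vector into its horizontal part and its component along `ξ`. -/
theorem eq_φ_φ_add (x : M) (w : TangentSpace (𝓡 (2 * n + 1)) x) :
    w = S.φ x (S.φ x w) + S.η x w • S.ξ x := by rw [S.φ_sq]; abel

/-- `∇ξ` is horizontal, as `ξ` has constant length. -/
theorem η_nabla_ξ (L : LeviCivita S.g) (x : M) (v : TangentSpace (𝓡 (2 * n + 1)) x) :
    S.η x (L.D S.ξ x v) = 0 := by
  have h := L.metric S.ξ S.ξ x v (S.ξ.diffAt x) (S.ξ.diffAt x)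
  simp only [S.g_ξ, S.η_ξ, mvfderiv_const, S.g_ξ_left] at h
  simp at h
  linarith

/-- The `ξ`-component of `∇(φ Y)`, from differentiating `g(φ Y, ξ) = 0`. -/
theorem η_nabla_φ (L : LeviCivita S.g) {Y : Π x : M, TangentSpace (𝓡 (2 * n + 1)) x} {x : M}
    (hY : FieldDiffAt Y x) (v : TangentSpace (𝓡 (2 * n + 1)) x) :
    S.η x (L.D (fun y ↦ S.φ y (Y y)) x v) = -S.g.inner x (S.φ x (Y x)) (L.D S.ξ x v) := by
  have h := L.metric _ _ x v (S.diffAt_φ hY) (S.ξ.diffAt x)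
  simp only [S.g_ξ, S.η_φ, mvfderiv_const] at h
  simp at h
  linarith

theorem nabla_φ_ξ (L : LeviCivita S.g) (x : M) : L.D (fun y ↦ S.φ y (S.ξ y)) x = 0 := by
  have h0 : (fun y ↦ S.φ y (S.ξ y)) = 0 := by ext1 y; simp
  rw [h0, L.D.isCovariantDerivativeOnUniv.zero]

theorem horizontal_zero : S.Horizontal 0 := fun _ ↦ map_zero _

namespace ParaSasakiLikeFor

variable [T2Space M] {L : LeviCivita S.g} (x : M)
  (v : TangentSpace (𝓡 (2 * n + 1)) x)

theorem nabla_ξ_horizontal (hF : S.ParaSasakiLikeFor L) (hv : S.η x v = 0) :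
    L.D S.ξ x v = S.φ x v := by
  obtain ⟨X, hX, rfl⟩ := S.exists_horizontal_eq hv
  apply S.g.ext_inner
  intro w
  obtain ⟨Y, hY, hYw⟩ := S.exists_horizontal_eq (S.η_φ x w)
  have h := (hF X Y 0 hX hY horizontal_zero x).2.2.2
  rw [F, map_sub, sub_apply, S.g_ξ, S.g_ξ, η_nabla_φ L (Y.diffAt x), S.η_φ, hYw] at h
  rw [eq_φ_φ_add (S := S) x w, map_add, map_add, map_smul, map_smul, S.g_ξ, η_nabla_ξ, S.g_ξ,
    S.η_φ, S.g_φ, S.g.symm x (L.D S.ξ x (X x)), S.η_φ]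
  simp only [smul_zero, mul_zero, add_zero, sub_zero] at h ⊢
  linarith

theorem nabla_ξ_ξ (hF : S.ParaSasakiLikeFor L) : L.D S.ξ x (S.ξ x) = 0 := by
  apply S.g.ext_inner
  intro w
  obtain ⟨Z, hZ, hZw⟩ := S.exists_horizontal_eq (S.η_φ x w)
  have h := (hF 0 0 Z horizontal_zero horizontal_zero hZ x).2.2.1
  rw [F, nabla_φ_ξ, hZw] at h
  simp only [zero_apply, zero_sub, map_neg, neg_apply, neg_eq_zero, S.g_φ_comm] at h
  rw [eq_φ_φ_add (S := S) x w, map_add, map_smul, S.g_ξ, η_nabla_ξ, h]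
  simp

theorem nabla_ξ (hF : S.ParaSasakiLikeFor L) : L.D S.ξ x v = S.φ x v := by
  have e : v = (v - S.η x v • S.ξ x) + S.η x v • S.ξ x := by abel
  rw [e, map_add, map_smul, hF.nabla_ξ_ξ, hF.nabla_ξ_horizontal _ _ (by simp [S.η_ξ])]
  simp

/-- The horizontal component of `(∇φ) Y` vanishes for horizontal `Y`. -/
theorem inner_nabla_φ_horizontal (hF : S.ParaSasakiLikeFor L) {Y Z : SmoothField (2 * n + 1) M}
    (hY : S.Horizontal Y) (hZ : S.Horizontal Z) :
    S.g.inner x (L.D (fun y ↦ S.φ y (Y y)) x v - S.φ x (L.D Y x v)) (Z x) = 0 := by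
  obtain ⟨V, hV, hVv⟩ := S.exists_horizontal_eq (x := x) (v := v - S.η x v • S.ξ x)
    (by simp [S.η_ξ])
  have h1 := (hF V Y Z hV hY hZ x).1
  have h2 := (hF V Y Z hV hY hZ x).2.1
  have e : v = V x + S.η x v • S.ξ x := by rw [hVv]; abel
  rw [F] at h1 h2
  have e1 : L.D (fun y ↦ S.φ y (Y y)) x v - S.φ x (L.D Y x v)
      = (L.D (fun y ↦ S.φ y (Y y)) x (V x) - S.φ x (L.D Y x (V x)))
        + S.η x v • (L.D (fun y ↦ S.φ y (Y y)) x (S.ξ x) - S.φ x (L.D Y x (S.ξ x))) := by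
    conv_lhs => rw [e]
    rw [map_add, map_add, map_add, map_smul, map_smul, map_smul]
    module
  rw [e1, map_add, add_apply, map_smul, smul_apply, h1, h2]
  simp

/-- The para-Sasaki-like identities for horizontal fields determine `∇ξ` and `∇φ` completely:
`(∇φ) Y` is tensorial in `Y`, its horizontal part comes from the `ξ`-component of `Y` only, and
its `ξ`-component is obtained from `∇ξ = φ`. -/
theorem nablaFormulas (hF : S.ParaSasakiLikeFor L) : S.NablaFormulas L := by
  refine ⟨hF.nabla_ξ, fun Y x hY v ↦ ?_⟩
  obtain ⟨T, hT⟩ : ∃ T : TangentSpace (𝓡 (2 * n + 1)) x →L[ℝ] TangentSpace (𝓡 (2 * n + 1)) x →L[ℝ]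
      TangentSpace (𝓡 (2 * n + 1)) x, ∀ Y : Π x : M, TangentSpace (𝓡 (2 * n + 1)) x,
        FieldDiffAt Y x → ∀ v, T (Y x) v = L.D (fun y ↦ S.φ y (Y y)) x v - S.φ x (L.D Y x v) :=
    ⟨TensorialAt.mkHom _ x (tensorialAt_nabla_φ L x), fun Y hY v ↦ by
      rw [TensorialAt.mkHom_apply (tensorialAt_nabla_φ L x) hY]; rfl⟩
  have Tξ : T (S.ξ x) v = -v + S.η x v • S.ξ x := by
    rw [hT _ (S.ξ.diffAt x), nabla_φ_ξ, hF.nabla_ξ, S.φ_sq, zero_apply]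
    abel
  have Tη (y) : S.g.inner x (T y v) (S.ξ x) = -S.g.inner x (S.φ x y) (S.φ x v) := by
    obtain ⟨Y, rfl⟩ := exists_smoothField_eq (m := 2 * n + 1) x y
    rw [hT _ (Y.diffAt x), S.g_ξ, map_sub, η_nabla_φ L (Y.diffAt x), S.η_φ, hF.nabla_ξ, sub_zero]
  have Thor (y z) (hy : S.η x y = 0) (hz : S.η x z = 0) : S.g.inner x (T y v) z = 0 := by
    obtain ⟨Y, hY, rfl⟩ := S.exists_horizontal_eq hy
    obtain ⟨Z, hZ, rfl⟩ := S.exists_horizontal_eq hz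
    rw [hT _ (Y.diffAt x)]
    exact hF.inner_nabla_φ_horizontal x v hY hZ
  have key (y) : T y v = -S.g.inner x v y • S.ξ x - S.η x y • v
      + (2 * S.η x v * S.η x y) • S.ξ x := by
    apply S.g.ext_inner
    intro z
    have h1 := Thor (S.φ x (S.φ x y)) (S.φ x (S.φ x z)) (S.η_φ x _) (S.η_φ x _)
    have h2 := Tη (S.φ x (S.φ x y))
    have h3 : S.g.inner x (T y v) z = S.g.inner x (T (S.φ x (S.φ x y)) v) (S.φ x (S.φ x z))
        + S.η x z * S.g.inner x (T (S.φ x (S.φ x y)) v) (S.ξ x)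
        + S.η x y * S.g.inner x (T (S.ξ x) v) z := by
      have e1 : T y v = T (S.φ x (S.φ x y)) v + S.η x y • T (S.ξ x) v := by
        conv_lhs => rw [eq_φ_φ_add (S := S) x y, map_add, map_smul]
        rfl
      have e2 (u) : S.g.inner x u z
          = S.g.inner x u (S.φ x (S.φ x z)) + S.η x z * S.g.inner x u (S.ξ x) := by
        conv_lhs => rw [eq_φ_φ_add (S := S) x z, map_add, map_smul]
        rfl
      rw [e1, map_add, map_smul, add_apply, smul_apply, smul_eq_mul, e2 (T (S.φ x (S.φ x y)) v)]
    rw [h3, h1, h2, Tξ, S.g_φ]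
    simp only [S.φ_sq, map_add, map_sub, map_smul, map_neg, add_apply, sub_apply, neg_apply,
      smul_apply, smul_eq_mul, S.g_ξ_left, S.η_ξ, S.g.symm x y v]
    ring
  have h := key (Y x)
  rw [hT Y hY, sub_eq_iff_eq_add] at h
  rw [h]
  module

end ParaSasakiLikeFor

end ApcpcR

end ParaSasaki

/-! ### The deformed structure and its Levi-Civita connection -/

namespace ParaSasaki

namespace ApcpcR

variable {n : ℕ} {M : Type*} [TopologicalSpace M]
  [ChartedSpace (EuclideanSpace ℝ (Fin (2 * n + 1))) M] [IsManifold (𝓡 (2 * n + 1)) ∞ M]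
  (S : ApcpcR n M)

section Form

/-- The symmetric bilinear form `a g + b g(φ ·, ·) + c η ⊗ η`. -/
def form (a b c : ℝ) (x : M) :
    TangentSpace (𝓡 (2 * n + 1)) x →L[ℝ] TangentSpace (𝓡 (2 * n + 1)) x →L[ℝ] ℝ :=
  a • S.g.inner x + b • (S.g.inner x).comp (S.φ x) + c • (S.η x).smulRight (S.η x)

variable (a b c : ℝ)

theorem form_apply (x : M) (v w : TangentSpace (𝓡 (2 * n + 1)) x) :
    S.form a b c x v w
      = a * S.g.inner x v w + b * S.g.inner x (S.φ x v) w + c * (S.η x v * S.η x w) := rfl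

theorem form_symm (x : M) (v w : TangentSpace (𝓡 (2 * n + 1)) x) :
    S.form a b c x v w = S.form a b c x w v := by
  rw [form_apply, form_apply, S.g_φ_comm, S.g.symm x v w, S.g.symm x v]
  ring

theorem smoothForm_g_φ : SmoothForm (fun x ↦ (S.g.inner x).comp (S.φ x)) := fun x ↦
  ContMDiffWithinAt.clm_bundle_comp (E₃ := fun x : M ↦ TangentSpace (𝓡 (2 * n + 1)) x →L[ℝ] ℝ)
      (S.g.contMDiff x) (S.φ_smooth x)

theorem smoothForm_η_η : SmoothForm (fun x ↦ (S.η x).smulRight (S.η x)) := fun x ↦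
  ContMDiffWithinAt.smulRight_section
      (E₂ := fun x : M ↦ TangentSpace (𝓡 (2 * n + 1)) x →L[ℝ] ℝ) (S.η_smooth x) (S.η_smooth x)

theorem smoothForm_form : SmoothForm (S.form a b c) :=
  ((SmoothForm.smul S.g.contMDiff a).add (S.smoothForm_g_φ.smul b)).add (S.smoothForm_η_η.smul c)

theorem diffAt_form {Y Z : Π x : M, TangentSpace (𝓡 (2 * n + 1)) x} {x : M}
    (hY : FieldDiffAt Y x) (hZ : FieldDiffAt Z x) :
    MDifferentiableAt (𝓡 (2 * n + 1)) 𝓘(ℝ) (fun y ↦ S.form a b c y (Y y) (Z y)) x := by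
  have := ((S.smoothForm_form a b c x).mdifferentiableAt (by simp)).clm_bundle_apply₂
    (E₃ := Trivial M ℝ) (F₃ := ℝ) hY hZ
  exact (mdifferentiableAt_totalSpace _ _).1 this |>.2

variable {S}

namespace NablaFormulas

variable {L : LeviCivita S.g}

theorem mvfderiv_η (h : S.NablaFormulas L) {Y : Π x : M, TangentSpace (𝓡 (2 * n + 1)) x} {x : M}
    (hY : FieldDiffAt Y x) (v : TangentSpace (𝓡 (2 * n + 1)) x) :
    mvfderiv (𝓡 (2 * n + 1)) (fun y ↦ S.η y (Y y)) x v
      = S.η x (L.D Y x v) + S.g.inner x (S.φ x v) (Y x) := by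
  have := L.metric Y S.ξ x v hY (S.ξ.diffAt x)
  simpa only [S.g_ξ, h.nabla_ξ, S.g.symm x (Y x)] using this

/-- The Leibniz rule for `a g + b g(φ ·, ·) + c η ⊗ η`; the last two summands are its covariant
derivative. -/
theorem mvfderiv_form (h : S.NablaFormulas L) {Y Z : Π x : M, TangentSpace (𝓡 (2 * n + 1)) x}
    {x : M} (hY : FieldDiffAt Y x) (hZ : FieldDiffAt Z x) (v : TangentSpace (𝓡 (2 * n + 1)) x) :
    mvfderiv (𝓡 (2 * n + 1)) (fun y ↦ S.form a b c y (Y y) (Z y)) x v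
      = S.form a b c x (L.D Y x v) (Z x) + S.form a b c x (Y x) (L.D Z x v)
        + b * (2 * S.η x v * S.η x (Y x) * S.η x (Z x) - S.g.inner x v (Y x) * S.η x (Z x)
          - S.η x (Y x) * S.g.inner x v (Z x))
        + c * (S.g.inner x (S.φ x v) (Y x) * S.η x (Z x)
          + S.η x (Y x) * S.g.inner x (S.φ x v) (Z x)) := by
  have d1 := S.g.diffAt_inner hY hZ
  have d2 := S.g.diffAt_inner (S.diffAt_φ hY) hZ
  have d3 := (S.diffAt_η hY).mul (S.diffAt_η hZ)
  have e : (fun y ↦ S.form a b c y (Y y) (Z y)) =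
      (a • (fun y ↦ S.g.inner y (Y y) (Z y)) + b • (fun y ↦ S.g.inner y (S.φ y (Y y)) (Z y)))
        + c • ((fun y ↦ S.η y (Y y)) * (fun y ↦ S.η y (Z y))) := rfl
  have smul (r : ℝ) {f : M → ℝ} (hf : MDifferentiableAt (𝓡 (2 * n + 1)) 𝓘(ℝ) f x) :
      mvfderiv (𝓡 (2 * n + 1)) (r • f) x v = r * mvfderiv (𝓡 (2 * n + 1)) f x v := by
    have := mvfderiv_smul (a := fun _ ↦ r) mdifferentiableAt_const hf
    have e : ((fun _ : M ↦ r) • f) = r • f := rfl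
    rw [e] at this
    rw [this]
    simp [mvfderiv_const]
  rw [e, mvfderiv_add ((d1.const_smul a).add (d2.const_smul b)) (d3.const_smul c),
    mvfderiv_add (d1.const_smul a) (d2.const_smul b), add_apply, add_apply,
    smul a d1, smul b d2, smul c d3, mvfderiv_mul (S.diffAt_η hY) (S.diffAt_η hZ),
    L.metric Y Z x v hY hZ, L.metric _ Z x v (S.diffAt_φ hY) hZ, h.nabla_φ Y x hY]
  simp only [add_apply, smul_apply, smul_eq_mul, h.mvfderiv_η hY, h.mvfderiv_η hZ, form_apply,
    map_add, map_sub, map_smul, sub_apply, S.g_ξ_left]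
  ring

end NablaFormulas

end Form

section Deform

variable {p q : ℝ}

/-- The deformed metric dominates a multiple of `g`, which is positive when `|q| < p`. -/
theorem form_self_ge (p q : ℝ) (x : M) (v : TangentSpace (𝓡 (2 * n + 1)) x) :
    min (p - |q|) 1 * S.g.inner x v v ≤ S.form p q (1 - p) x v v := by
  have h1 := S.abs_g_φ_self_le x v
  set G := S.g.inner x v v
  set e := S.η x v * S.η x v
  have he : 0 ≤ e := mul_self_nonneg _
  set f := S.g.inner x (S.φ x v) v
  have hG : 0 ≤ G - e := (abs_nonneg f).trans h1
  have h2 : -(|q| * (G - e)) ≤ q * f := by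
    have := (abs_mul q f).le.trans (mul_le_mul_of_nonneg_left h1 (abs_nonneg q))
    linarith [neg_abs_le (q * f)]
  have h3 : min (p - |q|) 1 * (G - e) ≤ (p - |q|) * (G - e) :=
    mul_le_mul_of_nonneg_right (min_le_left _ _) hG
  have h4 : min (p - |q|) 1 * e ≤ 1 * e := mul_le_mul_of_nonneg_right (min_le_right _ _) he
  rw [form_apply]
  change min (p - |q|) 1 * G ≤ p * G + q * f + (1 - p) * e
  linarith

/-- The Riemannian metric `p g + q g(φ ·, ·) + (1 - p) η ⊗ η` for `|q| < p`. -/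
def deformMetric (hpq : |q| < p) : Metric (2 * n + 1) M where
  inner := S.form p q (1 - p)
  symm := S.form_symm p q (1 - p)
  pos x v hv := lt_of_lt_of_le
    (mul_pos (lt_min (sub_pos.2 hpq) one_pos) (S.g.pos x v hv)) (S.form_self_ge p q x v)
  isVonNBounded x := by
    set r := min (p - |q|) 1
    have hr : 0 < r := lt_min (sub_pos.2 hpq) one_pos
    have hb := (S.g.isVonNBounded x).image
      ((√r)⁻¹ • ContinuousLinearMap.id ℝ (TangentSpace (𝓡 (2 * n + 1)) x))
    refine hb.subset fun v hv ↦ ?_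
    refine ⟨√r • v, ?_, ?_⟩
    · have := (S.form_self_ge p q x v).trans_lt hv
      simpa [← mul_assoc, Real.mul_self_sqrt hr.le] using this
    · simp [smul_smul, (Real.sqrt_pos.2 hr).ne']
  contMDiff := S.smoothForm_form p q (1 - p)

/-- The paracontact homothetic deformation of `S` with `w = 0` (which keeps `ξ` and `η`),
`p = exp (2u) cosh (2v)` and `q = exp (2u) sinh (2v)`. -/
def deform (hpq : |q| < p) : ApcpcR n M where
  φ := S.φ
  φ_smooth := S.φ_smooth
  ξ := S.ξ
  η := S.η
  η_smooth := S.η_smooth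
  g := S.deformMetric hpq
  φ_sq := S.φ_sq
  η_ξ := S.η_ξ
  finrank_pos := S.finrank_pos
  finrank_neg := S.finrank_neg
  g_ξ x v := by
    change S.form p q (1 - p) x v (S.ξ x) = _
    rw [form_apply, S.g_ξ, S.g_ξ, S.η_φ, S.η_ξ]
    ring
  g_φ x v w := by
    change S.form p q (1 - p) x (S.φ x v) (S.φ x w) = S.form p q (1 - p) x v w - _
    rw [form_apply, form_apply, S.g_φ, S.g_φ, S.η_φ, S.η_φ]
    ring

theorem isParacontactHomothetic_deform (hpq : |q| < p) :
    S.IsParacontactHomothetic (S.deform hpq) := by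
  have h1 : 0 < p + q := by linarith [neg_abs_le q]
  have h2 : 0 < p - q := by linarith [le_abs_self q]
  -- `exp (2 (u ± v)) = p ± q`
  set u := (Real.log (p + q) + Real.log (p - q)) / 4 with hu
  set v := (Real.log (p + q) - Real.log (p - q)) / 4 with hv
  have e1 : Real.exp (2 * u) * Real.exp (2 * v) = p + q := by
    rw [← Real.exp_add, ← Real.exp_log h1, Real.exp_eq_exp, hu, hv]
    ring
  have e2 : Real.exp (2 * u) * Real.exp (-(2 * v)) = p - q := by
    rw [← Real.exp_add, ← Real.exp_log h2, Real.exp_eq_exp, hu, hv]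
    ring
  have c : Real.exp (2 * u) * Real.cosh (2 * v) = p := by
    rw [Real.cosh_eq]; linarith
  have s : Real.exp (2 * u) * Real.sinh (2 * v) = q := by
    rw [Real.sinh_eq]; linarith
  refine ⟨u, v, 0, fun _ ↦ rfl, fun x ↦ ?_, fun x ↦ ?_, fun x y z ↦ ?_⟩
  · rw [neg_zero, Real.exp_zero, one_smul]; rfl
  · rw [Real.exp_zero, one_smul]; rfl
  · rw [c, s, mul_zero, Real.exp_zero, ← S.g_φ_comm]; rfl

end Deform

section Connection

variable {S} {p q : ℝ}

variable (S) (p q) in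
/-- The difference `∇̄ - ∇` of the Levi-Civita connections of the deformed and the original metric:
it maps `Y` and `v` to `B(Y, v) ξ`, where `B = -q g + (1 - p) g(φ ·, ·) + q η ⊗ η`. -/
def deformDiff (x : M) : TangentSpace (𝓡 (2 * n + 1)) x →L[ℝ]
    TangentSpace (𝓡 (2 * n + 1)) x →L[ℝ] TangentSpace (𝓡 (2 * n + 1)) x :=
  ((ContinuousLinearMap.toSpanSingleton ℝ (S.ξ x)).postcomp _).comp (S.form (-q) (1 - p) q x)

/-- The Levi-Civita connection of the deformed metric. -/
def NablaFormulas.deform {L : LeviCivita S.g} (h : S.NablaFormulas L) (hpq : |q| < p) :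
    LeviCivita (S.deform hpq).g where
  D := L.D.addOneForm (S.deformDiff p q)
  smooth := ⟨⟨fun {Y} hY ↦ by
    refine (L.smooth.contMDiff.contMDiff hY).add_section fun x hx ↦ ?_
    exact ContMDiffWithinAt.smulRight_section
      ((S.smoothForm_form (-q) (1 - p) q x).contMDiffWithinAt.clm_bundle_apply
        (E₂ := fun x : M ↦ TangentSpace (𝓡 (2 * n + 1)) x →L[ℝ] ℝ) (hY x hx))
      (S.ξ.contMDiff x).contMDiffWithinAt⟩⟩
  torsion_free X Y x hX hY := by
    change L.D Y x (X x) + S.form (-q) (1 - p) q x (Y x) (X x) • S.ξ x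
      - (L.D X x (Y x) + S.form (-q) (1 - p) q x (X x) (Y x) • S.ξ x) = _
    rw [← L.torsion_free X Y x hX hY, S.form_symm _ _ _ x (Y x)]
    abel
  metric Y Z x v hY hZ := by
    change mvfderiv (𝓡 (2 * n + 1)) (fun y ↦ S.form p q (1 - p) y (Y y) (Z y)) x v
      = S.form p q (1 - p) x (L.D Y x v + S.form (-q) (1 - p) q x (Y x) v • S.ξ x) (Z x)
        + S.form p q (1 - p) x (Y x) (L.D Z x v + S.form (-q) (1 - p) q x (Z x) v • S.ξ x)
    rw [h.mvfderiv_form _ _ _ hY hZ]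
    simp only [map_add, map_smul, add_apply, smul_apply, smul_eq_mul, form_apply, S.g_ξ, S.g_ξ_left,
      S.η_ξ, S.η_φ, S.φ_ξ, map_zero, zero_apply, S.g_φ_comm x v, S.g.symm x v]
    ring

variable {L : LeviCivita S.g} (h : S.NablaFormulas L) (hpq : |q| < p)

theorem NablaFormulas.deform_D_apply (Y : Π x : M, TangentSpace (𝓡 (2 * n + 1)) x) (x : M)
    (v : TangentSpace (𝓡 (2 * n + 1)) x) :
    (h.deform hpq).D Y x v = L.D Y x v + S.form (-q) (1 - p) q x (Y x) v • S.ξ x := rfl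

/-- The deformed structure is again para-Sasaki-like. -/
theorem NablaFormulas.paraSasakiLikeFor_deform :
    (S.deform hpq).ParaSasakiLikeFor (h.deform hpq) := by
  -- the tensor `F` of the deformed structure for arbitrary fields
  have key (X Y Z : SmoothField (2 * n + 1) M) (x : M) :
      (S.deform hpq).F (h.deform hpq) X Y Z x = S.form p q (1 - p) x
        (-S.g.inner x (X x) (Y x) • S.ξ x - S.η x (Y x) • X x
          + (2 * S.η x (X x) * S.η x (Y x)) • S.ξ x
          + S.form (-q) (1 - p) q x (S.φ x (Y x)) (X x) • S.ξ x) (Z x) := by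
    change S.form p q (1 - p) x (L.D (fun y ↦ S.φ y (Y y)) x (X x)
      + S.form (-q) (1 - p) q x (S.φ x (Y x)) (X x) • S.ξ x
      - S.φ x (L.D Y x (X x) + S.form (-q) (1 - p) q x (Y x) (X x) • S.ξ x)) (Z x) = _
    rw [h.nabla_φ _ x (Y.diffAt x), map_add, map_smul, S.φ_ξ]
    congr 2
    module
  intro X Y Z hX hY hZ x
  have hXx : S.η x (X x) = 0 := hX x
  have hYx : S.η x (Y x) = 0 := hY x
  have hZx : S.η x (Z x) = 0 := hZ x
  have hξ : (S.deform hpq).ξ = S.ξ := rfl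
  have hg : (S.deform hpq).g.inner x (X x) (Y x) = S.form p q (1 - p) x (X x) (Y x) := rfl
  simp only [hξ, key, hg]
  refine ⟨?_, ?_, ?_, ?_⟩ <;>
  · simp only [map_add, map_sub, map_smul, add_apply, sub_apply, smul_apply,
      smul_eq_mul, form_apply, S.g_ξ, S.g_ξ_left, S.η_ξ, S.η_φ, S.φ_ξ, map_zero, zero_apply,
      S.φ_sq, hXx, hYx, hZx, S.g_φ_comm x (X x), S.g.symm x (X x)]
    ring

end Connection

end ApcpcR

end ParaSasaki

/-! ### Curvature and Ricci tensor of the deformed structure -/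

namespace ParaSasaki

theorem LeviCivita.diffAt_D {m : ℕ} {M : Type*} [TopologicalSpace M]
    [ChartedSpace (EuclideanSpace ℝ (Fin m)) M] [IsManifold (𝓡 m) ∞ M] {g : Metric m M}
    (L : LeviCivita g) (Z : SmoothField m M) {Y : Π x : M, TangentSpace (𝓡 m) x} {x : M}
    (hY : FieldDiffAt Y x) : FieldDiffAt (fun y ↦ L.D Z y (Y y)) x := by
  have := L.smooth.contMDiff.contMDiff (σ := Z) (by simpa using Z.contMDiff.contMDiffOn)
  exact ((this.contMDiffAt Filter.univ_mem (x := x)).mdifferentiableAt (by simp)).clm_bundle_apply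
    hY

namespace ApcpcR

variable {n : ℕ} {M : Type*} [TopologicalSpace M]
  [ChartedSpace (EuclideanSpace ℝ (Fin (2 * n + 1))) M] [IsManifold (𝓡 (2 * n + 1)) ∞ M]
  {S : ApcpcR n M}

section Curvature

variable {p q : ℝ} {L : LeviCivita S.g} (h : S.NablaFormulas L) (hpq : |q| < p)

namespace NablaFormulas

/-- Second covariant derivatives for the deformed metric; the term quadratic in `B` vanishes since
`B(ξ, ·) = 0`. -/
theorem deform_nabla_nabla {Y : Π x : M, TangentSpace (𝓡 (2 * n + 1)) x}
    (Z : SmoothField (2 * n + 1) M) {x : M} (hY : FieldDiffAt Y x)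
    (v : TangentSpace (𝓡 (2 * n + 1)) x) :
    (h.deform hpq).D (fun y ↦ (h.deform hpq).D Z y (Y y)) x v
      = L.D (fun y ↦ L.D Z y (Y y)) x v
        + (S.form (-q) (1 - p) q x (L.D Z x (Y x)) v
          + mvfderiv (𝓡 (2 * n + 1)) (fun y ↦ S.form (-q) (1 - p) q y (Z y) (Y y)) x v) • S.ξ x
        + S.form (-q) (1 - p) q x (Z x) (Y x) • S.φ x v := by
  have hc := L.D.isCovariantDerivativeOn (s := Set.univ)
  have hB := S.diffAt_form (-q) (1 - p) q (Z.diffAt x) hY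
  have hξ := S.ξ.diffAt x
  have e : (fun y ↦ (h.deform hpq).D Z y (Y y)) = (fun y ↦ L.D Z y (Y y))
      + (fun y ↦ S.form (-q) (1 - p) q y (Z y) (Y y)) • (fun y ↦ S.ξ y) := rfl
  have e1 : L.D (fun y ↦ S.ξ y) x v = S.φ x v := h.nabla_ξ x v
  have e2 : S.form (-q) (1 - p) q x (S.ξ x) v = 0 := by
    rw [form_apply, S.φ_ξ, S.g_ξ_left, S.η_ξ, map_zero, zero_apply]
    ring
  have e3 : S.form (-q) (1 - p) q x ((h.deform hpq).D Z x (Y x)) v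
      = S.form (-q) (1 - p) q x (L.D Z x (Y x)) v := by
    rw [h.deform_D_apply, map_add, add_apply, map_smul, smul_apply, e2, smul_zero, add_zero]
  rw [h.deform_D_apply, e3, e, hc.add (L.diffAt_D Z hY) (hB.smul_section hξ), hc.leibniz hξ hB]
  simp only [add_apply, smul_apply, ContinuousLinearMap.smulRight_apply, e1]
  module

/-- The antisymmetrised derivative of `B = -q g + (1 - p) g(φ ·, ·) + q η ⊗ η`. As `∇` is
torsion-free, only `∇B` contributes. -/
theorem antisymm_nabla_form (h : S.NablaFormulas L) (p q : ℝ)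
    {X Y Z : Π x : M, TangentSpace (𝓡 (2 * n + 1)) x} {x : M}
    (hX : FieldDiffAt X x) (hY : FieldDiffAt Y x) (hZ : FieldDiffAt Z x) :
    S.form (-q) (1 - p) q x (L.D Z x (Y x)) (X x)
      + mvfderiv (𝓡 (2 * n + 1)) (fun y ↦ S.form (-q) (1 - p) q y (Z y) (Y y)) x (X x)
      - (S.form (-q) (1 - p) q x (L.D Z x (X x)) (Y x)
        + mvfderiv (𝓡 (2 * n + 1)) (fun y ↦ S.form (-q) (1 - p) q y (Z y) (X y)) x (Y x))
      - S.form (-q) (1 - p) q x (Z x) (mlieBracket (𝓡 (2 * n + 1)) X Y x)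
      = (1 - p) * (S.g.inner x (Z x) (Y x) * S.η x (X x) - S.η x (Y x) * S.g.inner x (Z x) (X x))
        + q * (S.η x (Y x) * S.g.inner x (S.φ x (Z x)) (X x)
          - S.g.inner x (S.φ x (Z x)) (Y x) * S.η x (X x)) := by
  have e1 (w w' : TangentSpace (𝓡 (2 * n + 1)) x) :
      S.g.inner x (S.φ x w) w' = S.g.inner x (S.φ x w') w := by rw [S.g_φ_comm, S.g.symm]
  rw [h.mvfderiv_form _ _ _ hZ hY, h.mvfderiv_form _ _ _ hZ hX, ← L.torsion_free X Y x hX hY,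
    map_sub, e1 (X x) (Z x), e1 (Y x) (Z x), e1 (X x) (Y x),
    S.g.symm x (X x) (Z x), S.g.symm x (Y x) (Z x), S.g.symm x (X x) (Y x)]
  ring

/-- The curvature of the deformed metric in terms of `B` and the connection of the original one. -/
theorem curvature_deform_eq_add {X : Π x : M, TangentSpace (𝓡 (2 * n + 1)) x}
    (Y Z : SmoothField (2 * n + 1) M) {x : M} (hX : FieldDiffAt X x) :
    (h.deform hpq).curvature X Y Z x = L.curvature X Y Z x
      + S.form (-q) (1 - p) q x (Z x) (Y x) • S.φ x (X x)
      - S.form (-q) (1 - p) q x (Z x) (X x) • S.φ x (Y x)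
      + (S.form (-q) (1 - p) q x (L.D Z x (Y x)) (X x)
        + mvfderiv (𝓡 (2 * n + 1)) (fun y ↦ S.form (-q) (1 - p) q y (Z y) (Y y)) x (X x)
        - (S.form (-q) (1 - p) q x (L.D Z x (X x)) (Y x)
          + mvfderiv (𝓡 (2 * n + 1)) (fun y ↦ S.form (-q) (1 - p) q y (Z y) (X y)) x (Y x))
        - S.form (-q) (1 - p) q x (Z x) (mlieBracket (𝓡 (2 * n + 1)) X Y x)) • S.ξ x := by
  rw [LeviCivita.curvature, LeviCivita.curvature, h.deform_nabla_nabla hpq Z (Y.diffAt x),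
    h.deform_nabla_nabla hpq Z hX, h.deform_D_apply]
  module

/-- The curvature of the deformed metric, with `∇B` written out. -/
theorem curvature_deform {X : Π x : M, TangentSpace (𝓡 (2 * n + 1)) x}
    (Y Z : SmoothField (2 * n + 1) M) {x : M} (hX : FieldDiffAt X x) :
    (h.deform hpq).curvature X Y Z x = L.curvature X Y Z x
      + S.form (-q) (1 - p) q x (Z x) (Y x) • S.φ x (X x)
      - S.form (-q) (1 - p) q x (Z x) (X x) • S.φ x (Y x)
      + ((1 - p) * (S.g.inner x (Z x) (Y x) * S.η x (X x) - S.η x (Y x) * S.g.inner x (Z x) (X x))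
        + q * (S.η x (Y x) * S.g.inner x (S.φ x (Z x)) (X x)
          - S.g.inner x (S.φ x (Z x)) (Y x) * S.η x (X x))) • S.ξ x := by
  rw [h.curvature_deform_eq_add hpq Y Z hX, h.antisymm_nabla_form p q hX (Y.diffAt x) (Z.diffAt x)]

/-- The deformation does not change the Ricci tensor: the difference of the curvatures is
`B(Y, Z) φ`, which is trace-free, plus two rank one maps whose traces cancel. -/
theorem ricci_deform (Y Z : SmoothField (2 * n + 1) M) (x : M) :
    (h.deform hpq).ricci Y Z x = L.ricci Y Z x := by
  set b := S.form (-q) (1 - p) q x (Z x) with hb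
  set α : TangentSpace (𝓡 (2 * n + 1)) x →ₗ[ℝ] ℝ :=
    (1 - p) • (S.g.inner x (Z x) (Y x) • (S.η x).toLinearMap
      - S.η x (Y x) • (S.g.inner x (Z x)).toLinearMap)
    + q • (S.η x (Y x) • (S.g.inner x (S.φ x (Z x))).toLinearMap
      - S.g.inner x (S.φ x (Z x)) (Y x) • (S.η x).toLinearMap) with hα
  have key : (TensorialAt.mkHom (fun X ↦ (h.deform hpq).curvature X Y Z x) x
        ((h.deform hpq).curvature_tensorial Y Z x)).toLinearMap
      = (TensorialAt.mkHom (fun X ↦ L.curvature X Y Z x) x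
        (L.curvature_tensorial Y Z x)).toLinearMap + b (Y x) • (S.φ x).toLinearMap
        - b.toLinearMap.smulRight (S.φ x (Y x)) + α.smulRight (S.ξ x) := by
    ext1 v
    have hv := FiberBundle.mdifferentiableAt_extend (𝓡 (2 * n + 1))
      (EuclideanSpace ℝ (Fin (2 * n + 1))) v
    have e := h.curvature_deform hpq Y Z hv
    rw [FiberBundle.extend_apply_self] at e
    refine e.trans ?_
    rfl
  have : FiniteDimensional ℝ (TangentSpace (𝓡 (2 * n + 1)) x) :=
    inferInstanceAs (FiniteDimensional ℝ (EuclideanSpace ℝ (Fin (2 * n + 1))))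
  rw [LeviCivita.ricci, LeviCivita.ricci, key, map_add, map_sub, map_add, map_smul, S.trace_φ,
    LinearMap.trace_smulRight, LinearMap.trace_smulRight]
  simp [hb, hα, form_apply, S.g_φ, S.η_ξ, S.g_ξ, ← S.g_φ_comm]
  ring

end NablaFormulas

end Curvature

section Einstein

variable [T2Space M]

/-- On a para-Sasaki-like manifold, deforming by the constants `p / (p² - q²)`, `-q / (p² - q²)`
turns the `η`-paracomplex-Einstein identity with constants `p, q` into `Ric = -2n g`. -/
theorem IsParaSasakiLike.exists_einsteinAt (hS : S.IsParaSasakiLike) {p q : ℝ} (hpq : |q| < p) :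
    ∃ S' : ApcpcR n M, S.IsParacontactHomothetic S' ∧ S'.IsParaSasakiLike ∧
      ∀ x : M, S.EtaParacomplexEinsteinAt p q x → S'.EinsteinAt (-2 * n) x := by
  obtain ⟨L, hL⟩ := hS
  have h : S.NablaFormulas L := ParaSasakiLikeFor.nablaFormulas hL
  have hd : 0 < p ^ 2 - q ^ 2 := sub_pos.2 (sq_lt_sq' (neg_lt_of_abs_lt hpq) (lt_of_abs_lt hpq))
  have hpq' : |-q / (p ^ 2 - q ^ 2)| < p / (p ^ 2 - q ^ 2) := by
    rw [abs_div, abs_neg, abs_of_pos hd]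
    exact div_lt_div_of_pos_right hpq hd
  refine ⟨S.deform hpq', S.isParacontactHomothetic_deform hpq',
    ⟨h.deform hpq', h.paraSasakiLikeFor_deform hpq'⟩, fun x ⟨L₁, hx⟩ ↦ ?_⟩
  refine ⟨(h.congr L₁).deform hpq', fun X Y ↦ ?_⟩
  change _ = _ * S.form _ _ _ x (X x) (Y x)
  rw [(h.congr L₁).ricci_deform hpq', hx, form_apply, S.g_φ_comm]
  field_simp
  ring

end Einstein

end ApcpcR

end ParaSasaki

end

theorem proposition4p6 {n : ℕ} {M : Type*} [TopologicalSpace M] [T2Space M]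
    [SecondCountableTopology M] [ChartedSpace (EuclideanSpace ℝ (Fin (2 * n + 1))) M]
    [IsManifold (𝓡 (2 * n + 1)) ∞ M] (S : ParaSasaki.ApcpcR n M) (hS : S.IsParaSasakiLike) :
    (S.IsEtaParacomplexEinstein →
      ∃ S' : ParaSasaki.ApcpcR n M,
        S.IsParacontactHomothetic S' ∧ S'.IsParaSasakiLike ∧ S'.IsEinstein) ∧
    ∀ p q : ℝ, |q| < p →
      ∃ S' : ParaSasaki.ApcpcR n M,
        S.IsParacontactHomothetic S' ∧ S'.IsParaSasakiLike ∧
        ∀ x : M, S.EtaParacomplexEinsteinAt p q x → S'.EinsteinAt (-2 * n) x := by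
  refine ⟨fun ⟨p, q, hpq, hE⟩ ↦ ?_, fun p q hpq ↦ hS.exists_einsteinAt hpq⟩
  obtain ⟨S', h₁, h₂, h₃⟩ := hS.exists_einsteinAt hpq
  exact ⟨S', h₁, h₂, _, fun x ↦ h₃ x (hE x)⟩
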